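/- Let $I_0(z)=\sum_{k\ge 0}\frac{(z/2)^{2k}}{(k!)^2}$ be the modified Bessel function of the first kind of order zero and, for $t>0$ and locally integrable $f$ on $\mathbb R$, let $$S(t)f(x)=\frac{e^{-t/2}}{2}\int_{-t}^{t} I_0\!\left(\frac{\sqrt{t^2-y^2}}{2}\right) f(x-y)\,dy$$ be the solution operator of the linear damped wave equation $\partial_t^2u+\partial_tu-\partial_x^2u=0$ on $\mathbb R$ with $u(0)=0$, $\partial_tu(0)=f$. Let $\phi\in L^1(\mathbb R)\cap L^\infty(\mathbb R)$ with $\phi\ge 0$ almost everywhere. Assume that $\phi$ has a locally integrable weak derivative $\dot\phi$ and that there is a constant $C$ such that, for almost every $x\in\mathbb R$, $$\phi(x)\le C\inf_{y\in(x-1,x+1)}\phi(y),\qquad \phi(x)\le C\inf_{|y|<2|x|}\phi(y),\qquad |\dot\phi(x)|\le C\phi(x),$$ where the infima are essential infima. Assume moreover that for every $\delta>0$ there is a constant $C_\delta>0$ such that $e^{-\delta|x|}\le C_\delta\,\phi(x)$ for almost every $x\in\mathbb R$. Then for every $\sigma\in(1/2,1)$ there is a constant $C_\sigma>0$, depending only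 on $\sigma$ and $\phi$, such that for all $t\ge 2$ and all $x\in\mathbb R$ the function $s\mapsto S(s)\phi(x)$ is differentiable at $s=t$ and $$|\partial_tS(t)\phi(x)|\le C_\sigma\,t^{-2(1-\sigma)}\,S(t)\phi(x).$$ -/

import Mathlib

open MeasureTheory Set
open scoped ContDiff

namespace DampedWave

noncomputable section

/-- The modified Bessel function of the first kind of order zero,
`I₀(z) = ∑ₖ (z / 2)²ᵏ / (k!)²`. -/
def besselI0 (z : ℝ) : ℝ :=
  ∑' k : ℕ, (z / 2) ^ (2 * k) / (k.factorial : ℝ) ^ 2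

/-- The solution operator `S(t)` of the one-dimensional linear damped wave equation,
`S(t) f (x) = (e^{-t/2} / 2) ∫_{-t}^{t} I₀(√(t² - y²) / 2) f(x - y) dy`. -/
def S (t : ℝ) (f : ℝ → ℝ) (x : ℝ) : ℝ :=
  Real.exp (-t / 2) / 2 *
    ∫ y in (-t)..t, besselI0 (Real.sqrt (t ^ 2 - y ^ 2) / 2) * f (x - y)

/-- `g` is the weak (distributional) derivative of `f` on the real line. -/
def IsWeakDeriv (f g : ℝ → ℝ) : Prop :=
  LocallyIntegrable f volume ∧ LocallyIntegrable g volume ∧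
    ∀ ψ : ℝ → ℝ, ContDiff ℝ ∞ ψ → HasCompactSupport ψ →
      ∫ x, f x * deriv ψ x = -∫ x, g x * ψ x

/-- The weight conditions on `φ`. As `φ` is an element of a Lebesgue space, infima are essential
infima and the derivative of `φ` is the weak one. -/
structure WeightConditions (φ : ℝ → ℝ) : Prop where
  /-- Comparison on intervals of radius one, comparison on dilated centred intervals, and control
  of the derivative, with a common constant `C`. -/
  comparison : ∃ C : ℝ,
    (∀ᵐ x : ℝ, φ x ≤ C * essInf φ (volume.restrict (Ioo (x - 1) (x + 1)))) ∧
    (∀ᵐ x : ℝ, φ x ≤ C * essInf φ (volume.restrict {y : ℝ | |y| < 2 * |x|})) ∧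
    ∃ φ' : ℝ → ℝ, IsWeakDeriv φ φ' ∧ ∀ᵐ x : ℝ, |φ' x| ≤ C * φ x
  /-- `φ` decays more slowly than any exponential. -/
  slow_decay : ∀ δ : ℝ, 0 < δ → ∃ Cδ : ℝ, 0 < Cδ ∧
    ∀ᵐ x : ℝ, Real.exp (-δ * |x|) ≤ Cδ * φ x

end

end DampedWave

/-!
With `J` the entire function such that `J (r ^ 2) = I₀ (r / 2)`, the kernel of `S t` is
`e^{-t/2} J (t² - y²) / 2`, and
`∂ₜ S(t) f (x) = e^{-t/2} / 2 * (f (x - t) + f (x + t) + ∫ (2 t J' - J / 2) (t² - y²) f (x - y) dy)`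
for continuous `f` (`hasDerivAt_S`). The weak derivative of the weight is bounded, so the weight has
a continuous representative, on which the comparison conditions hold pointwise
(`WeightConditions.exists_continuous_rep`).

For `|y| ≤ t ^ σ` the two terms `2 t J'` and `J / 2` nearly cancel. With `r² = t² - y²`, the Bessel
inequalities `(1 - 1 / z) I₀ z ≤ I₁ z ≤ I₀ z` read `(1 - 2 / r) J ≤ 4 r J' ≤ J` at `r ^ 2`
(`le_four_mul_besselJ'_sq`, `four_mul_besselJ'_sq_le`), and `t / r = 1 + O(t ^ (-2 (1 - σ)))`,
`1 / r = O(1 / t)`. Hence the integrand is `O(t ^ (-2 (1 - σ)))` times that of `S t f x`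
(`exists_abs_kernel_deriv_le`).

For `t ^ σ ≤ |y| ≤ t` the kernel is at most `exp (-t ^ (2 σ - 1) / 4)` up to powers of `t`
(`exp_mul_besselJ_le`), and the boundary terms are of that size too. The comparison on dilated
intervals is a doubling condition: it forces at most polynomial decay of the weight, and
`f (x - y) ≤ A t ^ N f x` for `|y| ≤ t` uniformly in `x` (`exists_sub_le_pow_mul`). Since
`f x ≤ L t S(t) f (x)`, by comparison on unit intervals and the lower bound for the kernel near
`y = 0` (`le_mul_S`), the far contribution is smaller than any power of `t` relative to
`S(t) f (x)`. Positivity of the weight comes from the subexponential decay condition.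
-/

namespace DampedWave

/-! ### Everywhere convergent power series -/

theorem summable_coeff_mul_pow {c : ℕ → ℝ} (hc : ∀ k, |c k| ≤ 1 / (k.factorial : ℝ)) (w : ℝ) :
    Summable fun k => c k * w ^ k := by
  refine Summable.of_norm_bounded (Real.summable_pow_div_factorial |w|) fun k => ?_
  rw [Real.norm_eq_abs, abs_mul, abs_pow]
  calc |c k| * |w| ^ k ≤ 1 / (k.factorial : ℝ) * |w| ^ k := by gcongr; exact hc k
    _ = |w| ^ k / (k.factorial : ℝ) := by ring

/-- Termwise differentiation; the derived series is indexed so that it is again of the form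
`∑ c k * w ^ k`. -/
theorem hasDerivAt_tsum_coeff_mul_pow {c : ℕ → ℝ} (hc : ∀ k, |c k| ≤ 1 / (k.factorial : ℝ))
    (w : ℝ) :
    HasDerivAt (fun w => ∑' k, c k * w ^ k) (∑' k, ((k + 1 : ℕ) : ℝ) * c (k + 1) * w ^ k) w := by
  set R : ℝ := |w| + 1
  have hR : 0 ≤ R := by positivity
  have hu : Summable fun k : ℕ => (k : ℝ) * |c k| * R ^ (k - 1) := by
    rw [← summable_nat_add_iff 1]
    refine Summable.of_nonneg_of_le (fun k => by positivity) (fun k => ?_)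
      (Real.summable_pow_div_factorial R)
    have h := hc (k + 1)
    rw [Nat.factorial_succ] at h
    push_cast at h ⊢
    calc ((k : ℝ) + 1) * |c (k + 1)| * R ^ (k + 1 - 1)
        ≤ ((k : ℝ) + 1) * (1 / (((k : ℝ) + 1) * k.factorial)) * R ^ (k + 1 - 1) := by gcongr
      _ = R ^ k / k.factorial := by
        rw [Nat.add_sub_cancel]; field_simp
  have h := hasDerivAt_tsum_of_isPreconnected (t := Metric.ball (0 : ℝ) R)
    (g := fun k w => c k * w ^ k) (g' := fun k w => c k * ((k : ℝ) * w ^ (k - 1)))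
    (y₀ := 0) (y := w) hu
    Metric.isOpen_ball (convex_ball 0 R).isPreconnected
    (fun k y _ => (hasDerivAt_pow k y).const_mul _) (fun k y hy => ?_)
    (by simp [R]; positivity) (summable_coeff_mul_pow hc 0) (by simp [R])
  · refine h.congr_deriv ?_
    rw [tsum_eq_zero_add']
    · simp only [CharP.cast_eq_zero, zero_mul, mul_zero, zero_add, Nat.add_sub_cancel]
      exact tsum_congr fun k => by push_cast; ring
    · refine Summable.of_norm_bounded ((summable_nat_add_iff 1).2 hu) fun k => ?_
      simp only [norm_mul, norm_pow, Real.norm_eq_abs, Nat.abs_cast]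
      rw [← mul_assoc, mul_comm |c (k + 1)|]
      gcongr
      simp [R]
  · have hy' : |y| ≤ R := by simpa using (mem_ball_zero_iff.1 hy).le
    simp only [norm_mul, norm_pow, Real.norm_eq_abs, Nat.abs_cast]
    rw [← mul_assoc, mul_comm |c k|]
    gcongr

/-! ### The Bessel function as an entire function of the squared argument -/

noncomputable section

/-- The entire function `J` with `J (r ^ 2) = I₀ (r / 2)`. Written with it, the kernel of `S t` is
`J (t ^ 2 - y ^ 2)`, which is smooth up to and across the light cone `|y| = t`. -/
def besselJ (w : ℝ) : ℝ :=
  ∑' k : ℕ, 1 / (16 ^ k * (k.factorial : ℝ) ^ 2) * w ^ k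

/-- The derivative of `besselJ`, as a power series. -/
def besselJ' (w : ℝ) : ℝ :=
  ∑' k : ℕ, ((k + 1 : ℕ) : ℝ) * (1 / (16 ^ (k + 1) * ((k + 1).factorial : ℝ) ^ 2)) * w ^ k

end

theorem abs_besselJ_coeff_le (k : ℕ) :
    |1 / ((16 : ℝ) ^ k * (k.factorial : ℝ) ^ 2)| ≤ 1 / (k.factorial : ℝ) := by
  rw [abs_of_nonneg (by positivity)]
  have h1 : (1 : ℝ) ≤ k.factorial := by exact_mod_cast k.factorial_pos
  have h2 : (1 : ℝ) ≤ 16 ^ k := one_le_pow₀ (by norm_num)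
  apply one_div_le_one_div_of_le (by positivity)
  calc (k.factorial : ℝ) = 1 * (1 * k.factorial) := by ring
    _ ≤ 16 ^ k * (k.factorial * k.factorial) := by gcongr
    _ = _ := by ring

theorem besselJ'_coeff_eq (k : ℕ) :
    ((k + 1 : ℕ) : ℝ) * (1 / (16 ^ (k + 1) * ((k + 1).factorial : ℝ) ^ 2))
      = 1 / (16 * (k + 1)) * (1 / (16 ^ k * (k.factorial : ℝ) ^ 2)) := by
  rw [Nat.factorial_succ]
  push_cast
  rw [pow_succ]
  field_simp

theorem abs_besselJ'_coeff_le (k : ℕ) :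
    |((k + 1 : ℕ) : ℝ) * (1 / (16 ^ (k + 1) * ((k + 1).factorial : ℝ) ^ 2))|
      ≤ 1 / (k.factorial : ℝ) := by
  rw [besselJ'_coeff_eq, abs_mul]
  have h : |1 / (16 * ((k : ℝ) + 1))| ≤ 1 := by
    rw [abs_of_nonneg (by positivity), div_le_one (by positivity)]
    nlinarith [(Nat.cast_nonneg k : (0 : ℝ) ≤ k)]
  calc _ ≤ 1 * (1 / (k.factorial : ℝ)) := by gcongr; exact abs_besselJ_coeff_le k
    _ = _ := one_mul _

theorem besselI0_eq_besselJ {w : ℝ} (hw : 0 ≤ w) : besselI0 (Real.sqrt w / 2) = besselJ w := by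
  refine tsum_congr fun k => ?_
  rw [div_div, div_pow, pow_mul, Real.sq_sqrt hw, pow_mul]
  norm_num
  field_simp

theorem hasDerivAt_besselJ (w : ℝ) : HasDerivAt besselJ (besselJ' w) w :=
  hasDerivAt_tsum_coeff_mul_pow abs_besselJ_coeff_le w

theorem continuous_besselJ : Continuous besselJ :=
  continuous_iff_continuousAt.2 fun w => (hasDerivAt_besselJ w).continuousAt

theorem continuous_besselJ' : Continuous besselJ' :=
  continuous_iff_continuousAt.2 fun w =>
    (hasDerivAt_tsum_coeff_mul_pow abs_besselJ'_coeff_le w).continuousAt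

theorem besselJ_zero : besselJ 0 = 1 := by
  rw [besselJ, tsum_eq_single 0 (fun k hk => by simp [hk])]
  simp

theorem one_le_besselJ {w : ℝ} (hw : 0 ≤ w) : 1 ≤ besselJ w := by
  have h := (summable_coeff_mul_pow abs_besselJ_coeff_le w).le_tsum 0 (fun k _ => by positivity)
  simpa [besselJ] using h

theorem besselJ'_nonneg {w : ℝ} (hw : 0 ≤ w) : 0 ≤ besselJ' w :=
  tsum_nonneg fun k => by positivity

theorem besselJ'_le {w : ℝ} (hw : 0 ≤ w) : besselJ' w ≤ besselJ w / 16 := by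
  rw [besselJ, ← tsum_div_const]
  refine (summable_coeff_mul_pow abs_besselJ'_coeff_le w).tsum_le_tsum (fun k => ?_)
    ((summable_coeff_mul_pow abs_besselJ_coeff_le w).div_const 16)
  rw [besselJ'_coeff_eq]
  have h : 1 / (16 * ((k : ℝ) + 1)) ≤ 1 / 16 := by
    apply one_div_le_one_div_of_le (by norm_num)
    nlinarith [(Nat.cast_nonneg k : (0 : ℝ) ≤ k)]
  calc _ ≤ 1 / 16 * (1 / (16 ^ k * (k.factorial : ℝ) ^ 2)) * w ^ k := by gcongr
    _ = _ := by ring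

/-- The inequality `I₁ ≤ I₀`: the power series of `I₁` is bounded term by term by the mean of two
consecutive terms of that of `I₀`. -/
theorem four_mul_besselJ'_sq_le (r : ℝ) :
    4 * r * besselJ' (r ^ 2) ≤ besselJ (r ^ 2) := by
  have hs := summable_coeff_mul_pow abs_besselJ_coeff_le (r ^ 2)
  have hs' := summable_coeff_mul_pow abs_besselJ'_coeff_le (r ^ 2)
  have hs1 := (summable_nat_add_iff 1).2 hs
  have hshift := hs.tsum_eq_zero_add
  have key : 4 * r * besselJ' (r ^ 2) ≤
      ∑' k : ℕ, (1 / 2 * (1 / (16 ^ k * (k.factorial : ℝ) ^ 2) * (r ^ 2) ^ k) +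
        1 / 2 * (1 / (16 ^ (k + 1) * ((k + 1).factorial : ℝ) ^ 2) * (r ^ 2) ^ (k + 1))) := by
    rw [besselJ', ← tsum_mul_left]
    refine (hs'.mul_left _).tsum_le_tsum (fun k => ?_)
      ((hs.mul_left _).add (hs1.mul_left _))
    have h1 : 1 / (16 ^ (k + 1) * ((k + 1).factorial : ℝ) ^ 2) =
        1 / (16 * (k + 1) ^ 2) * (1 / (16 ^ k * (k.factorial : ℝ) ^ 2)) := by
      rw [Nat.factorial_succ]; push_cast; rw [pow_succ]; field_simp
    rw [besselJ'_coeff_eq, h1, pow_succ (r ^ 2)]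
    have hu : 0 ≤ 1 / (16 ^ k * (k.factorial : ℝ) ^ 2) * (r ^ 2) ^ k := by positivity
    generalize 1 / (16 ^ k * (k.factorial : ℝ) ^ 2) = b at *
    set u := b * (r ^ 2) ^ k
    set q := r / (4 * ((k : ℝ) + 1)) with hq
    have e1 : 4 * r * (1 / (16 * ((k : ℝ) + 1)) * b * (r ^ 2) ^ k) = q * u := by
      simp only [hq, u]; field_simp; ring
    have e2 : 1 / (16 * ((k : ℝ) + 1) ^ 2) * b * ((r ^ 2) ^ k * r ^ 2) = q ^ 2 * u := by
      simp only [hq, u]; field_simp; ring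
    rw [e1, e2]
    nlinarith [mul_nonneg (sq_nonneg (1 - q)) hu]
  rw [(hs.mul_left _).tsum_add (hs1.mul_left _), tsum_mul_left, tsum_mul_left] at key
  simp only [pow_zero, Nat.factorial_zero] at hshift
  change besselJ (r ^ 2) = _ at hshift
  change _ ≤ 1 / 2 * besselJ (r ^ 2) + _ at key
  norm_num at hshift key
  linarith

/-- The inequality `I₁ z ≥ (1 - 1 / z) I₀ z`. It expresses Jensen's inequality for the convex
function `1 / (k + 1)` under the weights given by the terms of `I₀`; termwise it is the tangent
line bound `x / (k + 1) ≥ 2 - (k + 1) / x` at `x = z / 2`. -/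
theorem le_four_mul_besselJ'_sq {r : ℝ} (hr : 0 < r) :
    (1 - 2 / r) * besselJ (r ^ 2) ≤ 4 * r * besselJ' (r ^ 2) := by
  have hs := summable_coeff_mul_pow abs_besselJ_coeff_le (r ^ 2)
  have hs' := summable_coeff_mul_pow abs_besselJ'_coeff_le (r ^ 2)
  -- the first moment of the weights is `r ^ 2 * besselJ' (r ^ 2)`
  have hm1 : Summable fun k : ℕ =>
      (k : ℝ) * (1 / (16 ^ k * (k.factorial : ℝ) ^ 2) * (r ^ 2) ^ k) := by
    rw [← summable_nat_add_iff 1]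
    refine (hs'.mul_left (r ^ 2)).congr fun k => by ring
  have hm : ∑' k : ℕ, (k : ℝ) * (1 / (16 ^ k * (k.factorial : ℝ) ^ 2) * (r ^ 2) ^ k)
      = r ^ 2 * besselJ' (r ^ 2) := by
    rw [hm1.tsum_eq_zero_add, besselJ', ← tsum_mul_left]
    simp only [CharP.cast_eq_zero, zero_mul, zero_add]
    exact tsum_congr fun k => by ring
  have key : ∑' k : ℕ, ((2 - 4 / r) * (1 / (16 ^ k * (k.factorial : ℝ) ^ 2) * (r ^ 2) ^ k) -
        4 / r * ((k : ℝ) * (1 / (16 ^ k * (k.factorial : ℝ) ^ 2) * (r ^ 2) ^ k)))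
      ≤ 4 * r * besselJ' (r ^ 2) := by
    rw [besselJ', ← tsum_mul_left]
    refine ((hs.mul_left _).sub (hm1.mul_left _)).tsum_le_tsum (fun k => ?_) (hs'.mul_left _)
    rw [besselJ'_coeff_eq]
    have hu : 0 ≤ 1 / (16 ^ k * (k.factorial : ℝ) ^ 2) * (r ^ 2) ^ k := by positivity
    rw [mul_assoc (1 / (16 * ((k : ℝ) + 1)))]
    set u := 1 / (16 ^ k * (k.factorial : ℝ) ^ 2) * (r ^ 2) ^ k
    have hq : 0 < r / (4 * ((k : ℝ) + 1)) := by positivity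
    have e1 : 4 * r * (1 / (16 * ((k : ℝ) + 1)) * u) = r / (4 * ((k : ℝ) + 1)) * u := by
      field_simp; ring
    have e2 : (2 - 4 / r) * u - 4 / r * (k * u) = (2 - (r / (4 * ((k : ℝ) + 1)))⁻¹) * u := by
      rw [inv_div]; field_simp; ring
    rw [e1, e2]
    refine mul_le_mul_of_nonneg_right ?_ hu
    set q := r / (4 * ((k : ℝ) + 1))
    have : q * q⁻¹ = 1 := mul_inv_cancel₀ hq.ne'
    nlinarith [sq_nonneg (q - 1), inv_pos.2 hq, mul_nonneg (sq_nonneg (q - 1)) (inv_pos.2 hq).le]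
  rw [(hs.mul_left _).tsum_sub (hm1.mul_left _), tsum_mul_left, tsum_mul_left, hm] at key
  change (2 - 4 / r) * besselJ (r ^ 2) - _ ≤ _ at key
  have e : 4 / r * (r ^ 2 * besselJ' (r ^ 2)) = 4 * r * besselJ' (r ^ 2) := by field_simp
  rw [e] at key
  have e3 : (2 - 4 / r) * besselJ (r ^ 2) = 2 * ((1 - 2 / r) * besselJ (r ^ 2)) := by ring
  linarith

theorem hasDerivAt_besselJ_sq (r : ℝ) :
    HasDerivAt (fun r => besselJ (r ^ 2)) (2 * r * besselJ' (r ^ 2)) r := by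
  have h := (hasDerivAt_besselJ (r ^ 2)).comp r (hasDerivAt_pow 2 r)
  refine h.congr_deriv ?_
  norm_num
  ring

/-- Integrated form of `I₁ ≤ I₀`: the function `e^{-z} I₀ z` decreases from its value `1` at `0`. -/
theorem besselJ_sq_le_exp {r : ℝ} (hr : 0 ≤ r) : besselJ (r ^ 2) ≤ Real.exp (r / 2) := by
  have hd : ∀ r : ℝ, HasDerivAt (fun r => besselJ (r ^ 2) * Real.exp (-r / 2))
      (2 * r * besselJ' (r ^ 2) * Real.exp (-r / 2) +
        besselJ (r ^ 2) * (Real.exp (-r / 2) * (-1 / 2))) r := fun r =>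
    (hasDerivAt_besselJ_sq r).mul (((hasDerivAt_id r).neg.div_const 2).exp)
  have hanti : AntitoneOn (fun r => besselJ (r ^ 2) * Real.exp (-r / 2)) (Ici 0) := by
    refine antitoneOn_of_deriv_nonpos (convex_Ici 0)
      (fun r _ => (hd r).continuousAt.continuousWithinAt)
      (fun r _ => (hd r).differentiableAt.differentiableWithinAt) fun r h => ?_
    rw [interior_Ici] at h
    rw [(hd r).deriv]
    nlinarith [four_mul_besselJ'_sq_le r, Real.exp_pos (-r / 2)]
  have h := hanti (mem_Ici.2 le_rfl) (mem_Ici.2 hr) hr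
  simp only [ne_eq, OfNat.ofNat_ne_zero, not_false_eq_true, zero_pow, besselJ_zero, neg_zero,
    zero_div, Real.exp_zero, mul_one] at h
  calc besselJ (r ^ 2) = besselJ (r ^ 2) * Real.exp (-r / 2) * Real.exp (r / 2) := by
        rw [mul_assoc, ← Real.exp_add]; simp [neg_div]
    _ ≤ 1 * Real.exp (r / 2) := by gcongr
    _ = _ := one_mul _

/-- Integrated form of `I₁ z ≥ (1 - 1 / z) I₀ z`: the function `z e^{-z} I₀ z` is increasing. -/
theorem exp_div_le_besselJ_sq {r : ℝ} (hr : 1 ≤ r) :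
    Real.exp ((r - 1) / 2) / r ≤ besselJ (r ^ 2) := by
  have hd : ∀ r : ℝ, HasDerivAt (fun r => r * (besselJ (r ^ 2) * Real.exp (-r / 2)))
      (1 * (besselJ (r ^ 2) * Real.exp (-r / 2)) +
        r * (2 * r * besselJ' (r ^ 2) * Real.exp (-r / 2) +
        besselJ (r ^ 2) * (Real.exp (-r / 2) * (-1 / 2)))) r := fun r =>
    (hasDerivAt_id r).mul
      ((hasDerivAt_besselJ_sq r).mul (((hasDerivAt_id r).neg.div_const 2).exp))
  have hmono : MonotoneOn (fun r => r * (besselJ (r ^ 2) * Real.exp (-r / 2))) (Ici 1) := by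
    refine monotoneOn_of_deriv_nonneg (convex_Ici 1)
      (fun r _ => (hd r).continuousAt.continuousWithinAt)
      (fun r _ => (hd r).differentiableAt.differentiableWithinAt) fun r h => ?_
    rw [interior_Ici] at h
    have h0 : 0 < r := lt_trans one_pos h
    rw [(hd r).deriv]
    have h1 := mul_le_mul_of_nonneg_left (le_four_mul_besselJ'_sq h0) h0.le
    have e : r * ((1 - 2 / r) * besselJ (r ^ 2)) = (r - 2) * besselJ (r ^ 2) := by field_simp
    rw [e] at h1
    have h2 := mul_le_mul_of_nonneg_right h1 (Real.exp_pos (-r / 2)).le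
    nlinarith [h2]
  have h := hmono (mem_Ici.2 le_rfl) (mem_Ici.2 hr) hr
  have h0 : 0 < r := lt_of_lt_of_le one_pos hr
  simp only [one_pow, one_mul] at h
  have h1 : Real.exp (-1 / 2) ≤ r * (besselJ (r ^ 2) * Real.exp (-r / 2)) :=
    le_trans (le_mul_of_one_le_left (Real.exp_pos _).le (one_le_besselJ zero_le_one)) h
  rw [div_le_iff₀ h0]
  calc Real.exp ((r - 1) / 2) = Real.exp (-1 / 2) * Real.exp (r / 2) := by
        rw [← Real.exp_add]; ring_nf
    _ ≤ r * (besselJ (r ^ 2) * Real.exp (-r / 2)) * Real.exp (r / 2) := by gcongr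
    _ = besselJ (r ^ 2) * r * (Real.exp (-r / 2) * Real.exp (r / 2)) := by ring
    _ = besselJ (r ^ 2) * r := by rw [← Real.exp_add]; simp [neg_div]

/-! ### Differentiation of the solution operator in time -/

open intervalIntegral in
/-- Leibniz rule over the symmetric interval `(-s, s)`. -/
theorem hasDerivAt_integral_neg_self {K K' : ℝ → ℝ → ℝ}
    (hK : Continuous (Function.uncurry K)) (hK' : Continuous (Function.uncurry K'))
    (hd : ∀ s y, HasDerivAt (fun s => K s y) (K' s y) s) (t : ℝ) :
    HasDerivAt (fun s => ∫ y in (-s)..s, K s y)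
      (K t t + K t (-t) + ∫ y in (-t)..t, K' t y) t := by
  have hKs : ∀ s, Continuous (K s) := fun s => hK.comp (Continuous.prodMk_right s)
  have hK's : ∀ s, Continuous (K' s) := fun s => hK'.comp (Continuous.prodMk_right s)
  -- the end points and the parameter of the integrand are varied separately
  have hsplit : ∀ a b, ∫ y in (-a)..a, K b y = (∫ y in (0)..a, K b y) - ∫ y in (0)..(-a), K b y :=
    fun a b => (integral_interval_sub_left ((hKs b).intervalIntegrable _ _)
      ((hKs b).intervalIntegrable _ _)).symm
  have hsplit' : ∀ a b, ∫ y in (-a)..a, K' b y =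
      (∫ y in (0)..a, K' b y) - ∫ y in (0)..(-a), K' b y :=
    fun a b => (integral_interval_sub_left ((hK's b).intervalIntegrable _ _)
      ((hK's b).intervalIntegrable _ _)).symm
  have hd1 : ∀ a b, HasDerivAt (fun a => ∫ y in (-a)..a, K b y) (K b a + K b (-a)) a := by
    intro a b
    simp_rw [hsplit]
    have h1 : ∀ c, HasDerivAt (fun a => ∫ y in (0)..a, K b y) (K b c) c := fun c =>
      integral_hasDerivAt_right ((hKs b).intervalIntegrable _ _)
        (hKs b).stronglyMeasurable.stronglyMeasurableAtFilter (hKs b).continuousAt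
    have h2 := (h1 (-a)).comp a (hasDerivAt_neg a)
    refine ((h1 a).sub h2).congr_deriv ?_
    ring
  have hd2 : ∀ a b, HasDerivAt (fun b => ∫ y in (-a)..a, K b y) (∫ y in (-a)..a, K' b y) b := by
    intro a b
    obtain ⟨M, hM⟩ := ((isCompact_closedBall b 1).prod
      (isCompact_uIcc (a := -a) (b := a))).exists_bound_of_continuousOn hK'.continuousOn
    refine (hasDerivAt_integral_of_dominated_loc_of_deriv_le (bound := fun _ => M)
      (Metric.closedBall_mem_nhds b one_pos)
      (Filter.Eventually.of_forall fun s => (hKs s).aestronglyMeasurable)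
      ((hKs b).intervalIntegrable _ _) (hK's b).aestronglyMeasurable
      (Filter.Eventually.of_forall fun y hy s hs => ?_) intervalIntegrable_const
      (Filter.Eventually.of_forall fun y _ s _ => hd s y)).2
    exact hM (s, y) ⟨hs, uIoc_subset_uIcc hy⟩
  have hc1 : Continuous fun p : ℝ × ℝ => K p.2 p.1 + K p.2 (-p.1) :=
    (hK.comp (continuous_snd.prodMk continuous_fst)).add
      (hK.comp (continuous_snd.prodMk continuous_fst.neg))
  have hc2 : Continuous fun p : ℝ × ℝ => ∫ y in (-p.1)..p.1, K' p.2 y := by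
    simp_rw [hsplit']
    have hu : Continuous (Function.uncurry fun p : ℝ × ℝ => K' p.2) :=
      hK'.comp ((continuous_snd.comp continuous_fst).prodMk continuous_snd)
    exact (continuous_parametric_intervalIntegral_of_continuous hu continuous_fst).sub
      (continuous_parametric_intervalIntegral_of_continuous hu continuous_fst.neg)
  have hF := hasStrictFDerivAt_uncurry_coprod (𝕜 := ℝ) (u := (t, t))
    (f := fun a b => ∫ y in (-a)..a, K b y)
    (f₁ := fun a b => ContinuousLinearMap.toSpanSingleton ℝ (K b a + K b (-a)))
    (f₂ := fun a b => ContinuousLinearMap.toSpanSingleton ℝ (∫ y in (-a)..a, K' b y))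
    (Filter.Eventually.of_forall fun v => (hd1 v.1 v.2).hasFDerivAt)
    (Filter.Eventually.of_forall fun v => (hd2 v.1 v.2).hasFDerivAt)
    ((ContinuousLinearMap.toSpanSingletonCLE (𝕜 := ℝ) (E := ℝ)).continuous.comp hc1).continuousAt
    ((ContinuousLinearMap.toSpanSingletonCLE (𝕜 := ℝ) (E := ℝ)).continuous.comp hc2).continuousAt
  have h := hF.hasFDerivAt.comp_hasDerivAt (f := fun s : ℝ => (s, s)) t
    ((hasDerivAt_id t).prodMk (hasDerivAt_id t))
  refine h.congr_deriv ?_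
  simp [Function.HasUncurry.uncurry]

theorem S_eq_integral_besselJ {t : ℝ} (ht : 0 ≤ t) (f : ℝ → ℝ) (x : ℝ) :
    S t f x = Real.exp (-t / 2) / 2 * ∫ y in (-t)..t, besselJ (t ^ 2 - y ^ 2) * f (x - y) := by
  rw [S]
  congr 1
  refine intervalIntegral.integral_congr fun y hy => ?_
  rw [uIcc_of_le (by linarith)] at hy
  have : 0 ≤ t ^ 2 - y ^ 2 := by nlinarith [hy.1, hy.2]
  simp only [besselI0_eq_besselJ this]

theorem S_congr_ae {f g : ℝ → ℝ} (h : f =ᵐ[volume] g) (t x : ℝ) : S t f x = S t g x := by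
  rw [S, S]
  congr 1
  refine intervalIntegral.integral_congr_ae ?_
  have h' := (quasiMeasurePreserving_sub_left (volume : Measure ℝ) x).ae h
  filter_upwards [h'] with y hy _
  rw [hy]

/-- Time derivative of the solution operator. The boundary terms carry the value `J 0 = 1` of the
kernel on the light cone. -/
theorem hasDerivAt_S {f : ℝ → ℝ} (hf : Continuous f) {t : ℝ} (ht : 0 < t) (x : ℝ) :
    HasDerivAt (fun s => S s f x)
      (Real.exp (-t / 2) / 2 * (f (x - t) + f (x + t) +
        ∫ y in (-t)..t, (2 * t * besselJ' (t ^ 2 - y ^ 2) - besselJ (t ^ 2 - y ^ 2) / 2) *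
          f (x - y))) t := by
  have hJ := continuous_besselJ
  have hJ' := continuous_besselJ'
  have hd := hasDerivAt_integral_neg_self
    (K := fun s y => besselJ (s ^ 2 - y ^ 2) * f (x - y))
    (K' := fun s y => 2 * s * besselJ' (s ^ 2 - y ^ 2) * f (x - y))
    (by unfold Function.uncurry; fun_prop) (by unfold Function.uncurry; fun_prop)
    (fun s y => by
      have h := (hasDerivAt_besselJ (s ^ 2 - y ^ 2)).comp s ((hasDerivAt_pow 2 s).sub_const (y ^ 2))
      refine (h.mul_const (f (x - y))).congr_deriv ?_
      push_cast
      ring) t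
  have hE : HasDerivAt (fun s : ℝ => Real.exp (-s / 2) / 2)
      (Real.exp (-t / 2) * (-1 / 2) / 2) t :=
    ((((hasDerivAt_id t).neg.div_const 2).exp).div_const 2)
  have hprod := hE.mul hd
  have heq : (fun s => S s f x) =ᶠ[nhds t]
      (fun s : ℝ => Real.exp (-s / 2) / 2 *
        ∫ y in (-s)..s, besselJ (s ^ 2 - y ^ 2) * f (x - y)) := by
    filter_upwards [Ioi_mem_nhds ht] with s hs using S_eq_integral_besselJ (le_of_lt hs) f x
  refine (hprod.congr_of_eventuallyEq heq).congr_deriv ?_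
  have hi : ∫ y in (-t)..t, (2 * t * besselJ' (t ^ 2 - y ^ 2) - besselJ (t ^ 2 - y ^ 2) / 2) *
          f (x - y) = (∫ y in (-t)..t, 2 * t * besselJ' (t ^ 2 - y ^ 2) * f (x - y)) -
          1 / 2 * ∫ y in (-t)..t, besselJ (t ^ 2 - y ^ 2) * f (x - y) := by
    rw [← intervalIntegral.integral_const_mul, ← intervalIntegral.integral_sub]
    · exact intervalIntegral.integral_congr fun y _ => by ring
    · exact Continuous.intervalIntegrable (by fun_prop) _ _
    · exact Continuous.intervalIntegrable (by fun_prop) _ _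
  rw [hi]
  simp only [neg_sq, sub_self, besselJ_zero, sub_neg_eq_add]
  ring

/-! ### The continuous representative of the weight -/

/-- The du Bois-Reymond lemma: a locally integrable function with zero weak derivative is almost
everywhere constant. -/
theorem exists_ae_eq_const_of_integral_mul_deriv_eq_zero {g : ℝ → ℝ}
    (hg : LocallyIntegrable g volume)
    (h : ∀ ψ : ℝ → ℝ, ContDiff ℝ ∞ ψ → HasCompactSupport ψ → ∫ x, g x * deriv ψ x = 0) :
    ∃ c : ℝ, ∀ᵐ x : ℝ, g x = c := by
  let b : ContDiffBump (0 : ℝ) := default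
  set η : ℝ → ℝ := b.normed volume
  have hη : ContDiff ℝ ∞ η := b.contDiff_normed
  have hηc : HasCompactSupport η := b.hasCompactSupport_normed
  have hη1 : ∫ x, η x = 1 := b.integral_normed
  have hint : ∀ ψ : ℝ → ℝ, Continuous ψ → HasCompactSupport ψ →
      Integrable (fun x => g x * ψ x) := fun ψ h1 h2 => by
    have := hg.integrable_smul_left_of_hasCompactSupport h1 h2
    exact this.congr (Filter.Eventually.of_forall fun x => by simp [mul_comm])
  refine ⟨∫ x, g x * η x, ?_⟩
  set c := ∫ x, g x * η x with hc
  have hgc : LocallyIntegrable (fun x => g x - c) volume :=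
    hg.sub (locallyIntegrable_const c)
  have key := ae_eq_zero_of_integral_contDiff_smul_eq_zero hgc fun ψ hψ hψc => ?_
  · filter_upwards [key] with x hx using sub_eq_zero.1 hx
  -- `ψ` minus a multiple of `η` has zero mean, so it is the derivative of a test function
  set m := ∫ x, ψ x with hm
  set ζ : ℝ → ℝ := fun x => ψ x - m * η x with hζ
  have hζd : ContDiff ℝ ∞ ζ := hψ.sub (contDiff_const.mul hη)
  have hζc : HasCompactSupport ζ := hψc.sub hηc.mul_left
  have hψi : Integrable ψ := hψ.continuous.integrable_of_hasCompactSupport hψc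
  have hηi : Integrable η := hη.continuous.integrable_of_hasCompactSupport hηc
  have hζ0 : ∫ x, ζ x = 0 := by
    rw [hζ, integral_sub hψi (hηi.const_mul m), integral_const_mul, hη1]
    simp [hm]
  obtain ⟨R, hR⟩ := hζc.isCompact.isBounded.subset_ball 0
  rw [Real.ball_eq_Ioo, zero_sub, zero_add] at hR
  have hout : ∀ x, x ∉ Ioo (-R) R → ζ x = 0 := fun x hx =>
    image_eq_zero_of_notMem_tsupport fun hx' => hx (hR hx')
  set Ψ : ℝ → ℝ := fun x => ∫ y in (-R)..x, ζ y with hΨ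
  have hΨd : ∀ x, HasDerivAt Ψ (ζ x) x := fun x =>
    intervalIntegral.integral_hasDerivAt_right (hζd.continuous.intervalIntegrable _ _)
      hζd.continuous.stronglyMeasurable.stronglyMeasurableAtFilter hζd.continuous.continuousAt
  have hderiv : deriv Ψ = ζ := funext fun x => (hΨd x).deriv
  have hΨs : ContDiff ℝ ∞ Ψ := by
    rw [contDiff_infty_iff_deriv, hderiv]
    exact ⟨fun x => (hΨd x).differentiableAt, hζd⟩
  have hΨc : HasCompactSupport Ψ := by
    refine HasCompactSupport.intro (isCompact_Icc (a := -R) (b := R)) fun x hx => ?_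
    rcases lt_or_ge x (-R) with h1 | h1
    · refine (intervalIntegral.integral_congr (g := fun _ => 0) fun y hy => ?_).trans (by simp)
      rw [uIcc_of_ge h1.le] at hy
      exact hout y fun h' => not_lt.2 hy.2 h'.1
    · have h2 : R < x := by
        by_contra h2
        exact hx ⟨h1, not_lt.1 h2⟩
      have hsub : Function.support ζ ⊆ Ioc (-R) x := fun y hy => by
        by_contra hy'
        exact hy (hout y fun h' => hy' ⟨h'.1, (h'.2.trans h2).le⟩)
      exact (intervalIntegral.integral_eq_integral_of_support_subset hsub).trans hζ0
  have h0 := h Ψ hΨs hΨc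
  rw [hderiv] at h0
  have e1 : ∫ x, g x * ζ x = (∫ x, g x * ψ x) - m * c := by
    rw [hc, ← integral_const_mul, ← integral_sub (hint ψ hψ.continuous hψc)
      ((hint η hη.continuous hηc).const_mul m)]
    exact integral_congr_ae (Filter.Eventually.of_forall fun x => by simp only [hζ]; ring)
  have e2 : ∫ x, ψ x • (g x - c) = (∫ x, g x * ψ x) - m * c := by
    rw [hm, ← integral_mul_const, ← integral_sub (hint ψ hψ.continuous hψc) (hψi.mul_const c)]
    exact integral_congr_ae (Filter.Eventually.of_forall fun x => by
      simp only [smul_eq_mul]; ring)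
  rw [e2, ← e1, h0]

/-- Up to a constant, a function with bounded weak derivative is almost everywhere the Lipschitz
primitive of that derivative. -/
theorem IsWeakDeriv.exists_continuous_ae_eq {φ φ' : ℝ → ℝ} (h : IsWeakDeriv φ φ') {D : ℝ}
    (hD : ∀ᵐ x : ℝ, |φ' x| ≤ D) : ∃ f : ℝ → ℝ, Continuous f ∧ φ =ᵐ[volume] f := by
  obtain ⟨hφ, hφ', hparts⟩ := h
  have hi : ∀ a b, IntervalIntegrable φ' volume a b := fun a b =>
    intervalIntegrable_iff.2
      ((hφ'.integrableOn_isCompact isCompact_uIcc).mono_set uIoc_subset_uIcc)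
  set P : ℝ → ℝ := fun x => ∫ y in (0)..x, φ' y with hP
  have hlip : LipschitzWith D.toNNReal P := by
    refine LipschitzWith.of_dist_le_mul fun x y => ?_
    rw [Real.dist_eq, Real.dist_eq, hP]
    simp only
    rw [intervalIntegral.integral_interval_sub_left (hi _ _) (hi _ _)]
    rw [← Real.norm_eq_abs]
    refine intervalIntegral.norm_integral_le_of_norm_le_const_ae ?_
    filter_upwards [hD] with z hz _ using hz.trans (Real.le_coe_toNNReal D)
  have hPd : ∀ᵐ x, lineDeriv ℝ P x 1 = φ' x := by
    filter_upwards [LocallyIntegrable.ae_hasDerivAt_integral hφ'] with x hx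
    simpa using ((hx 0).hasFDerivAt.hasLineDerivAt 1).lineDeriv
  have hzero : ∀ ψ : ℝ → ℝ, ContDiff ℝ ∞ ψ → HasCompactSupport ψ →
      ∫ x, (φ x - P x) * deriv ψ x = 0 := by
    intro ψ hψ hψc
    obtain ⟨K, hK⟩ := ContDiff.lipschitzWith_of_hasCompactSupport hψc hψ (by simp)
    have hψ'c : Continuous (deriv ψ) := hψ.continuous_deriv (by simp)
    have hP' : ∫ x, P x * deriv ψ x = -∫ x, φ' x * ψ x := by
      have h1 := hlip.integral_lineDeriv_mul_eq (μ := volume) hK hψc 1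
      have h2 : ∫ x, lineDeriv ℝ P x 1 * ψ x = ∫ x, φ' x * ψ x := by
        refine integral_congr_ae ?_
        filter_upwards [hPd] with x hx
        rw [hx]
      have h3 : ∀ x, lineDeriv ℝ ψ x (-1) * P x = -(P x * deriv ψ x) := fun x => by
        have hd : HasDerivAt ψ (deriv ψ x) x :=
          ((hψ.differentiable (by simp)) x).hasDerivAt
        rw [(hd.hasFDerivAt.hasLineDerivAt (-1)).lineDeriv]
        simp [mul_comm]
      simp_rw [h3, integral_neg] at h1
      rw [← h2, h1, neg_neg]
    have hint1 : Integrable fun x => φ x * deriv ψ x := by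
      have := hφ.integrable_smul_left_of_hasCompactSupport hψ'c hψc.deriv
      exact this.congr (Filter.Eventually.of_forall fun x => by simp [mul_comm])
    have hint2 : Integrable fun x => P x * deriv ψ x :=
      (hlip.continuous.mul hψ'c).integrable_of_hasCompactSupport hψc.deriv.mul_left
    simp_rw [sub_mul]
    rw [integral_sub hint1 hint2, hparts ψ hψ hψc, hP', sub_self]
  obtain ⟨c, hc⟩ := exists_ae_eq_const_of_integral_mul_deriv_eq_zero
    (hφ.sub hlip.continuous.locallyIntegrable) hzero
  refine ⟨fun x => P x + c, hlip.continuous.add continuous_const, ?_⟩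
  filter_upwards [hc] with x hx
  simp only [Pi.sub_apply] at hx
  linarith

/-! ### Pointwise consequences of the weight conditions -/

/-- For a continuous function, comparison at almost all pairs of points in an open set is comparison
at all of them. -/
theorem le_mul_of_ae_ae {f : ℝ → ℝ} (hf : Continuous f) {C : ℝ} {U : Set (ℝ × ℝ)} (hU : IsOpen U)
    (h : ∀ᵐ x : ℝ, ∀ᵐ y : ℝ, (x, y) ∈ U → f x ≤ C * f y) {x y : ℝ} (hxy : (x, y) ∈ U) :
    f x ≤ C * f y := by
  by_contra hlt
  have hV : IsOpen (U ∩ {p : ℝ × ℝ | C * f p.2 < f p.1}) :=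
    hU.inter (isOpen_lt (by fun_prop) (by fun_prop))
  obtain ⟨x', hx', hae⟩ := (Measure.dense_of_ae h).inter_open_nonempty _
    (hV.preimage (Continuous.prodMk_left y)) ⟨x, hxy, not_le.1 hlt⟩
  obtain ⟨y', hy', hle⟩ := (Measure.dense_of_ae hae).inter_open_nonempty _
    (hV.preimage (Continuous.prodMk_right x')) ⟨y, hx'⟩
  exact not_lt.2 (hle hy'.1) hy'.2

theorem ae_ae_le_of_ae_le_essInf {φ : ℝ → ℝ} (h0 : ∀ᵐ x : ℝ, 0 ≤ φ x) {C : ℝ} (hC : 0 ≤ C)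
    {U : Set (ℝ × ℝ)} (hU : IsOpen U)
    (h : ∀ᵐ x : ℝ, φ x ≤ C * essInf φ (volume.restrict {y | (x, y) ∈ U})) :
    ∀ᵐ x : ℝ, ∀ᵐ y : ℝ, (x, y) ∈ U → φ x ≤ C * φ y := by
  filter_upwards [h] with x hx
  have hm : MeasurableSet {y | (x, y) ∈ U} := (hU.preimage (Continuous.prodMk_right x)).measurableSet
  have hbdd : Filter.IsBoundedUnder (· ≥ ·) (ae (volume.restrict {y | (x, y) ∈ U})) φ :=
    ⟨0, Filter.eventually_map.2 (ae_restrict_of_ae h0)⟩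
  filter_upwards [(ae_restrict_iff' hm).1 (ae_essInf_le hbdd)] with y hy hyU
  exact hx.trans (mul_le_mul_of_nonneg_left (hy hyU) hC)

/-- The weight has a continuous representative, for which the comparison conditions hold at every
point. -/
theorem WeightConditions.exists_continuous_rep {φ : ℝ → ℝ} (hφ : WeightConditions φ)
    (h0 : ∀ᵐ x : ℝ, 0 ≤ φ x) (hinf : MemLp φ ⊤ volume) :
    ∃ f : ℝ → ℝ, Continuous f ∧ φ =ᵐ[volume] f ∧ (∀ x, 0 < f x) ∧ ∃ C : ℝ, 0 < C ∧
      (∀ x y, |y - x| < 1 → f x ≤ C * f y) ∧ (∀ x y, |y| < 2 * |x| → f x ≤ C * f y) := by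
  obtain ⟨C, h1, h2, φ', hw, hd⟩ := hφ.comparison
  obtain ⟨c₁, hc₁, hdec⟩ := hφ.slow_decay 1 one_pos
  have hpos : ∀ᵐ x : ℝ, 0 < φ x := by
    filter_upwards [hdec] with x hx
    exact pos_of_mul_pos_right ((Real.exp_pos _).trans_le hx) hc₁.le
  have hC : 0 ≤ C := by
    obtain ⟨x, hx, hx'⟩ := (hpos.and hd).exists
    exact nonneg_of_mul_nonneg_left ((abs_nonneg _).trans hx') hx
  obtain ⟨M, hM⟩ : ∃ M : ℝ, ∀ᵐ x : ℝ, |φ x| ≤ M := by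
    refine ⟨(eLpNorm φ ⊤ volume).toReal, ?_⟩
    filter_upwards [ae_le_eLpNormEssSup (f := φ) (μ := volume)] with x hx
    rw [← eLpNorm_exponent_top] at hx
    have := ENNReal.toReal_mono hinf.2.ne hx
    simpa using this
  obtain ⟨f, hf, hφf⟩ := hw.exists_continuous_ae_eq (D := C * M) (by
    filter_upwards [hd, hM] with x hx hx'
    exact hx.trans (mul_le_mul_of_nonneg_left ((le_abs_self _).trans hx') hC))
  have transfer : ∀ U : Set (ℝ × ℝ), IsOpen U →
      (∀ᵐ x : ℝ, φ x ≤ C * essInf φ (volume.restrict {y | (x, y) ∈ U})) →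
      ∀ x y, (x, y) ∈ U → f x ≤ C * f y := fun U hU h x y hxy => by
    refine le_mul_of_ae_ae hf hU ?_ hxy
    filter_upwards [ae_ae_le_of_ae_le_essInf h0 hC hU h, hφf] with x hx hx'
    filter_upwards [hx, hφf] with y hy hy'
    rwa [← hx', ← hy']
  have hfpos : ∀ x, 0 < f x := fun x => by
    have hle : Real.exp (-1 * |x|) ≤ c₁ * f x := by
      have hcl : IsClosed {x : ℝ | Real.exp (-1 * |x|) ≤ c₁ * f x} :=
        isClosed_le (by fun_prop) (by fun_prop)
      have hae : ∀ᵐ x : ℝ, Real.exp (-1 * |x|) ≤ c₁ * f x := by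
        filter_upwards [hdec, hφf] with x hx hx'
        rwa [← hx']
      exact hcl.closure_subset (Measure.dense_of_ae hae x)
    exact pos_of_mul_pos_right ((Real.exp_pos _).trans_le hle) hc₁.le
  have hnear := transfer {p | |p.2 - p.1| < 1} (isOpen_lt (by fun_prop) (by fun_prop)) (by
    filter_upwards [h1] with x hx
    convert hx using 4
    ext y
    simp only [mem_ofPred_eq, mem_Ioo, abs_lt]
    constructor <;> rintro ⟨_, _⟩ <;> constructor <;> linarith)
  have hfar := transfer {p | |p.2| < 2 * |p.1|} (isOpen_lt (by fun_prop) (by fun_prop)) h2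
  have hC' : 0 < C := by
    have := hnear 0 0 (by simp)
    exact pos_of_mul_pos_left ((hfpos 0).trans_le this) (hfpos 0).le
  exact ⟨f, hf, hφf, hfpos, C, hC', hnear, hfar⟩

/-- Comparison on dilated intervals is a doubling condition, which bounds the weight from below by
a power. -/
theorem exists_le_pow_mul {f : ℝ → ℝ} (hpos : ∀ x, 0 < f x) {C : ℝ} (hC : 0 < C)
    (hfar : ∀ x y, |y| < 2 * |x| → f x ≤ C * f y) :
    ∃ (N : ℕ) (c : ℝ), 0 < c ∧ ∀ x T, 1 ≤ T → |x| ≤ T → c ≤ T ^ N * f x := by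
  obtain ⟨N, hN⟩ := pow_unbounded_of_one_lt C (by norm_num : (1 : ℝ) < 3 / 2)
  -- the dilation factor must be less than `2`
  have hgeom : ∀ n : ℕ, f 1 ≤ C ^ n * f ((3 / 2) ^ n) := by
    intro n
    induction n with
    | zero => simp
    | succ n ih =>
      have h := hfar ((3 / 2) ^ n) ((3 / 2) ^ (n + 1)) (by
        rw [abs_of_pos (by positivity), abs_of_pos (by positivity), pow_succ]
        have : (0 : ℝ) < (3 / 2) ^ n := by positivity
        linarith)
      calc f 1 ≤ C ^ n * f ((3 / 2) ^ n) := ih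
        _ ≤ C ^ n * (C * f ((3 / 2) ^ (n + 1))) := by gcongr
        _ = _ := by ring
  refine ⟨N, f 1 / C, div_pos (hpos 1) hC, fun x T hT hx => ?_⟩
  obtain ⟨n, hn1, hn2⟩ := exists_nat_pow_near hT (by norm_num : (1 : ℝ) < 3 / 2)
  have h := hfar ((3 / 2) ^ n) x (by
    rw [abs_of_pos (a := (3 / 2 : ℝ) ^ n) (by positivity)]
    rw [pow_succ] at hn2
    have : (0 : ℝ) < (3 / 2) ^ n := by positivity
    linarith)
  have hCn : C ^ n ≤ T ^ N := by
    calc C ^ n ≤ ((3 / 2) ^ N) ^ n := by gcongr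
      _ = ((3 / 2) ^ n) ^ N := by rw [← pow_mul, ← pow_mul, mul_comm]
      _ ≤ T ^ N := by gcongr
  rw [div_le_iff₀ hC]
  have hx0 := hpos x
  calc f 1 ≤ C ^ n * f ((3 / 2) ^ n) := hgeom n
    _ ≤ C ^ n * (C * f x) := by gcongr
    _ ≤ T ^ N * (C * f x) := by gcongr
    _ = _ := by ring

/-- Inside the domain of dependence the weight exceeds its value at the centre at most by a factor
polynomial in time, uniformly in the centre. -/
theorem exists_sub_le_pow_mul {f : ℝ → ℝ} (hpos : ∀ x, 0 < f x) {C : ℝ} (hC : 0 < C)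
    (hfar : ∀ x y, |y| < 2 * |x| → f x ≤ C * f y) :
    ∃ (N : ℕ) (A : ℝ), 0 < A ∧ ∀ t, 2 ≤ t → ∀ x y, |y| ≤ t → f (x - y) ≤ A * t ^ N * f x := by
  obtain ⟨N, c, hc, hlow⟩ := exists_le_pow_mul hpos hC hfar
  -- the weight is largest, up to a factor, at the origin
  have hmax : ∀ z, f z ≤ (C + 1) * f 0 := fun z => by
    by_cases hz : z = 0
    · rw [hz]; nlinarith [hpos 0]
    · have := hfar z 0 (by simpa using hz)
      nlinarith [hpos 0]
  have hf0 := hpos 0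
  refine ⟨N, C + (C + 1) * f 0 * 2 ^ N / c, by positivity, fun t ht x y hy => ?_⟩
  have hfx := hpos x
  have ht1 : 1 ≤ t ^ N := one_le_pow₀ (by linarith)
  by_cases h : |x| < 2 * |x - y|
  · calc f (x - y) ≤ C * 1 * f x := by rw [mul_one]; exact hfar _ _ h
      _ ≤ (C + (C + 1) * f 0 * 2 ^ N / c) * t ^ N * f x := by
        gcongr
        exact le_add_of_nonneg_right (by positivity)
  · have hx : |x| ≤ 2 * t := by
      have := abs_sub_abs_le_abs_sub x (x - y)
      rw [sub_sub_cancel] at this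
      linarith
    have h1 := hlow x (2 * t) (by linarith) hx
    rw [mul_pow] at h1
    calc f (x - y) ≤ (C + 1) * f 0 := hmax _
      _ = (C + 1) * f 0 / c * c := by field_simp
      _ ≤ (C + 1) * f 0 / c * (2 ^ N * t ^ N * f x) := by gcongr
      _ = ((C + 1) * f 0 * 2 ^ N / c) * t ^ N * f x := by ring
      _ ≤ (C + (C + 1) * f 0 * 2 ^ N / c) * t ^ N * f x := by
        gcongr
        exact le_add_of_nonneg_left hC.le

/-! ### Kernel bounds near and far from the axis -/

/-- Crude bound for the differentiated kernel, used where the kernel itself is tiny. -/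
theorem abs_kernel_deriv_le {t w : ℝ} (ht : 2 ≤ t) (hw : 0 ≤ w) :
    |2 * t * besselJ' w - besselJ w / 2| ≤ t * besselJ w := by
  have h1 := besselJ'_nonneg hw
  have h2 := besselJ'_le hw
  have h3 := one_le_besselJ hw
  rw [abs_le]
  constructor <;> nlinarith

/-- Near the axis the differentiated kernel gains the factor `t ^ (-2 * (1 - σ))`. -/
theorem exists_abs_kernel_deriv_le {σ : ℝ} (hσ : 1 / 2 < σ) (hσ' : σ < 1) :
    ∃ K : ℝ, 0 < K ∧ ∀ t y : ℝ, 2 ≤ t → |y| ≤ t ^ σ →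
      |2 * t * besselJ' (t ^ 2 - y ^ 2) - besselJ (t ^ 2 - y ^ 2) / 2| ≤
        K * t ^ (-2 * (1 - σ)) * besselJ (t ^ 2 - y ^ 2) := by
  set δ : ℝ := 2 ^ (-2 * (1 - σ)) with hδ
  have hδ1 : δ < 1 := Real.rpow_lt_one_of_one_lt_of_neg (by norm_num) (by linarith)
  set κ : ℝ := Real.sqrt (1 - δ)
  have hκ : 0 < κ := Real.sqrt_pos.2 (by linarith)
  have hκ2 : κ ^ 2 = 1 - δ := Real.sq_sqrt (by linarith)
  refine ⟨1 / κ, by positivity, fun t y ht hy => ?_⟩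
  have ht0 : 0 < t := by linarith
  set τ : ℝ := t ^ (-2 * (1 - σ)) with hτ
  have hτ0 : 0 < τ := Real.rpow_pos_of_pos ht0 _
  have hτδ : τ ≤ δ := Real.rpow_le_rpow_of_nonpos (by norm_num) ht (by linarith)
  have hτt : 1 ≤ t * τ := by
    have h := Real.one_le_rpow (x := t) (z := 1 + -2 * (1 - σ)) (by linarith) (by linarith)
    rwa [Real.rpow_add ht0, Real.rpow_one] at h
  have hy2 : y ^ 2 ≤ t ^ 2 * τ := by
    have h : y ^ 2 ≤ (t ^ σ) ^ 2 := sq_le_sq' (by linarith [neg_abs_le y]) ((le_abs_self y).trans hy)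
    refine h.trans_eq ?_
    rw [hτ, ← Real.rpow_natCast, ← Real.rpow_natCast, ← Real.rpow_mul ht0.le,
      ← Real.rpow_add ht0]
    congr 1
    push_cast
    ring
  have hw : (κ * t) ^ 2 ≤ t ^ 2 - y ^ 2 := by
    rw [mul_pow, hκ2]
    nlinarith [mul_le_mul_of_nonneg_left hτδ (sq_nonneg t)]
  have hw0 : 0 ≤ t ^ 2 - y ^ 2 := (sq_nonneg _).trans hw
  set r : ℝ := Real.sqrt (t ^ 2 - y ^ 2)
  have hr2 : r ^ 2 = t ^ 2 - y ^ 2 := Real.sq_sqrt hw0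
  have hrκ : κ * t ≤ r := Real.le_sqrt_of_sq_le hw
  have hr0 : 0 < r := lt_of_lt_of_le (by positivity) hrκ
  have hrt : r ≤ t := Real.sqrt_le_iff.2 ⟨ht0.le, by nlinarith [sq_nonneg y]⟩
  rw [← hr2]
  have hJ := one_le_besselJ (sq_nonneg r)
  have hJ' := besselJ'_nonneg (sq_nonneg r)
  have hup := four_mul_besselJ'_sq_le r
  have hlow := le_four_mul_besselJ'_sq hr0
  set J := besselJ (r ^ 2)
  set J' := besselJ' (r ^ 2)
  have hinv : 1 / r ≤ 1 / κ * τ := by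
    rw [div_le_iff₀ hr0]
    calc (1 : ℝ) ≤ t * τ := hτt
      _ = 1 / κ * τ * (κ * t) := by field_simp
      _ ≤ 1 / κ * τ * r := by gcongr
  -- `t - r = y ^ 2 / (t + r)`
  have htr : t - r ≤ t * τ := by
    have : t * (t - r) ≤ t * (t * τ) := by nlinarith
    exact le_of_mul_le_mul_left this ht0
  have htr' : (t - r) / r ≤ 1 / κ * τ := by
    rw [div_le_iff₀ hr0]
    calc t - r ≤ t * τ := htr
      _ = 1 / κ * τ * (κ * t) := by field_simp
      _ ≤ 1 / κ * τ * r := by gcongr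
  rw [abs_le]
  constructor
  · have h1 : 2 * r * J' ≤ 2 * t * J' := by gcongr
    have h2 : 1 / r * J ≤ 1 / κ * τ * J := by gcongr
    have h3 : (1 - 2 / r) * J = J - 2 * (1 / r * J) := by ring
    linarith
  · have h1 : 2 * t * J' = t / r / 2 * (4 * r * J') := by field_simp; ring
    have h2 : t / r / 2 * (4 * r * J') ≤ t / r / 2 * J := by gcongr
    have h3 : t / r / 2 * J = J / 2 + 1 / 2 * ((t - r) / r * J) := by field_simp; ring
    have h4 : (t - r) / r * J ≤ 1 / κ * τ * J := by gcongr
    have h5 : 0 ≤ 1 / κ * τ * J := by positivity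
    linarith

/-- Smallness of the kernel away from the axis, from `√(t² - y²) ≤ t - y² / (2 t)`. -/
theorem exp_mul_besselJ_le {σ t y : ℝ} (ht : 0 < t) (hy : t ^ σ ≤ |y|) (hyt : |y| ≤ t) :
    Real.exp (-t / 2) * besselJ (t ^ 2 - y ^ 2) ≤ Real.exp (-(t ^ (2 * σ - 1) / 4)) := by
  have hy2 : y ^ 2 ≤ t ^ 2 := sq_le_sq' (by linarith [neg_abs_le y]) ((le_abs_self y).trans hyt)
  have hw0 : 0 ≤ t ^ 2 - y ^ 2 := by linarith
  have hty : t ^ (2 * σ - 1) * t ≤ y ^ 2 := by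
    rw [← Real.rpow_add_one ht.ne', ← sq_abs y]
    have h : (t ^ σ) ^ 2 ≤ |y| ^ 2 := by gcongr
    refine le_trans (le_of_eq ?_) h
    rw [← Real.rpow_natCast, ← Real.rpow_mul ht.le]
    congr 1
    push_cast
    ring
  have hr : Real.sqrt (t ^ 2 - y ^ 2) ≤ t - y ^ 2 / (2 * t) := by
    have h1 : y ^ 2 / (2 * t) ≤ t := by
      rw [div_le_iff₀ (by positivity)]
      nlinarith
    refine Real.sqrt_le_iff.2 ⟨by linarith, ?_⟩
    have h2 : t * (y ^ 2 / (2 * t)) = y ^ 2 / 2 := by field_simp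
    nlinarith [sq_nonneg (y ^ 2 / (2 * t))]
  have h3 : t ^ (2 * σ - 1) ≤ 2 * (y ^ 2 / (2 * t)) := by
    have : 2 * (y ^ 2 / (2 * t)) = y ^ 2 / t := by field_simp
    rw [this, le_div_iff₀ ht]
    exact hty
  have hJ := besselJ_sq_le_exp (Real.sqrt_nonneg (t ^ 2 - y ^ 2))
  rw [Real.sq_sqrt hw0] at hJ
  calc _ ≤ Real.exp (-t / 2) * Real.exp (Real.sqrt (t ^ 2 - y ^ 2) / 2) := by gcongr
    _ = Real.exp (-t / 2 + Real.sqrt (t ^ 2 - y ^ 2) / 2) := (Real.exp_add _ _).symm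
    _ ≤ _ := Real.exp_le_exp.2 (by linarith)

theorem le_exp_mul_besselJ {t y : ℝ} (ht : 2 ≤ t) (hy : |y| ≤ 1) :
    Real.exp (-1) / t ≤ Real.exp (-t / 2) * besselJ (t ^ 2 - y ^ 2) := by
  have hy2 : y ^ 2 ≤ 1 := (sq_le_one_iff_abs_le_one y).2 hy
  have hw0 : 0 ≤ t ^ 2 - y ^ 2 := by nlinarith
  have hr1 : t - 1 ≤ Real.sqrt (t ^ 2 - y ^ 2) := Real.le_sqrt_of_sq_le (by nlinarith)
  have hrt : Real.sqrt (t ^ 2 - y ^ 2) ≤ t :=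
    Real.sqrt_le_iff.2 ⟨by linarith, by nlinarith [sq_nonneg y]⟩
  have hJ := exp_div_le_besselJ_sq (show 1 ≤ Real.sqrt (t ^ 2 - y ^ 2) by linarith)
  rw [Real.sq_sqrt hw0] at hJ
  set r := Real.sqrt (t ^ 2 - y ^ 2)
  have hr0 : 0 < r := by linarith
  calc Real.exp (-1) / t = Real.exp (-t / 2) * (Real.exp ((t - 1 - 1) / 2) / t) := by
        rw [mul_div_assoc', ← Real.exp_add]; ring_nf
    _ ≤ Real.exp (-t / 2) * (Real.exp ((r - 1) / 2) / r) := by gcongr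
    _ ≤ _ := by gcongr

theorem exists_pow_mul_exp_neg_rpow_le {a : ℝ} (ha : 0 < a) (n : ℕ) :
    ∃ G : ℝ, 0 < G ∧ ∀ t : ℝ, 1 ≤ t → t ^ n * Real.exp (-(t ^ a / 4)) ≤ G := by
  obtain ⟨m, hm⟩ := exists_nat_ge ((n : ℝ) / a)
  refine ⟨4 ^ m * m.factorial, by positivity, fun t ht => ?_⟩
  have ht0 : 0 < t := by linarith
  have h1 : t ^ n ≤ (t ^ a) ^ m := by
    rw [← Real.rpow_natCast, ← Real.rpow_natCast, ← Real.rpow_mul ht0.le]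
    exact Real.rpow_le_rpow_of_exponent_le ht (by rw [div_le_iff₀ ha] at hm; linarith)
  have h2 := Real.pow_div_factorial_le_exp (t ^ a / 4) (by positivity) m
  rw [div_le_iff₀ (by positivity), div_pow, div_le_iff₀ (by positivity)] at h2
  rw [Real.exp_neg, ← div_eq_mul_inv, div_le_iff₀ (Real.exp_pos _)]
  calc t ^ n ≤ _ := h1.trans h2
    _ = _ := by ring

/-! ### The estimate of the time derivative -/

/-- The contribution of `|y| ≤ 1 / 2` bounds `S t f x` from below by a multiple of `f x / t`. -/
theorem le_mul_S {f : ℝ → ℝ} (hf : Continuous f) (hpos : ∀ x, 0 < f x) {C : ℝ} (hC : 0 < C)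
    (hnear : ∀ x y, |y - x| < 1 → f x ≤ C * f y) {t : ℝ} (ht : 2 ≤ t) (x : ℝ) :
    f x ≤ 2 * Real.exp 1 * C * t * S t f x := by
  have hJ := continuous_besselJ
  have ht0 : 0 < t := by linarith
  rw [S_eq_integral_besselJ ht0.le, ← intervalIntegral.integral_const_mul]
  set g : ℝ → ℝ := fun y => Real.exp (-t / 2) / 2 * (besselJ (t ^ 2 - y ^ 2) * f (x - y)) with hg
  have hgc : Continuous g := by fun_prop
  have hg0 : ∀ y ∈ Icc (-t) t, 0 ≤ g y := fun y hy => by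
    have h1 := one_le_besselJ (w := t ^ 2 - y ^ 2) (by nlinarith [hy.1, hy.2])
    have h2 := hpos (x - y)
    positivity
  have hlow : ∀ y ∈ Icc (-(1 / 2) : ℝ) (1 / 2), Real.exp (-1) / t / 2 * (f x / C) ≤ g y := by
    intro y hy
    have hy' : |y| ≤ 1 / 2 := abs_le.2 hy
    have h1 := le_exp_mul_besselJ ht (y := y) (by linarith)
    have h2 : f x / C ≤ f (x - y) := by
      rw [div_le_iff₀ hC, mul_comm]
      refine hnear x (x - y) ?_
      rw [sub_sub_cancel_left, abs_neg]
      linarith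
    have h3 := hpos x
    have h4 : 0 ≤ Real.exp (-t / 2) * besselJ (t ^ 2 - y ^ 2) := le_trans (by positivity) h1
    calc Real.exp (-1) / t / 2 * (f x / C)
        ≤ Real.exp (-t / 2) * besselJ (t ^ 2 - y ^ 2) / 2 * f (x - y) := by gcongr
      _ = g y := by rw [hg]; ring
  have h1 : ∫ y in (-(1 / 2) : ℝ)..(1 / 2), Real.exp (-1) / t / 2 * (f x / C) ≤
      ∫ y in (-(1 / 2) : ℝ)..(1 / 2), g y :=
    intervalIntegral.integral_mono_on (by norm_num) intervalIntegrable_const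
      (hgc.intervalIntegrable _ _) hlow
  have h2 : ∫ y in (-(1 / 2) : ℝ)..(1 / 2), g y ≤ ∫ y in (-t)..t, g y := by
    refine intervalIntegral.integral_mono_interval (by linarith) (by norm_num) (by linarith) ?_
      (hgc.intervalIntegrable _ _)
    filter_upwards [ae_restrict_mem measurableSet_Ioc] with y hy using hg0 y ⟨hy.1.le, hy.2⟩
  have h3 := h1.trans h2
  rw [intervalIntegral.integral_const] at h3
  norm_num at h3
  calc f x = 2 * Real.exp 1 * C * t * (Real.exp (-1) / t / 2 * (f x / C)) := by
        rw [Real.exp_neg]; field_simp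
    _ ≤ _ := by gcongr

theorem exists_abs_deriv_S_le {f : ℝ → ℝ} (hf : Continuous f) (hpos : ∀ x, 0 < f x)
    {C : ℝ} (hC : 0 < C) (hnear : ∀ x y, |y - x| < 1 → f x ≤ C * f y)
    (hfar : ∀ x y, |y| < 2 * |x| → f x ≤ C * f y) {σ : ℝ} (hσ : 1 / 2 < σ) (hσ' : σ < 1) :
    ∃ B : ℝ, 0 < B ∧ ∀ t : ℝ, 2 ≤ t → ∀ x : ℝ,
      |deriv (fun s => S s f x) t| ≤ B * t ^ (-2 * (1 - σ)) * S t f x := by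
  obtain ⟨K, hK, hker⟩ := exists_abs_kernel_deriv_le hσ hσ'
  obtain ⟨N, A, hA, hgrow⟩ := exists_sub_le_pow_mul hpos hC hfar
  obtain ⟨G, hG, hexp⟩ := exists_pow_mul_exp_neg_rpow_le (a := 2 * σ - 1) (by linarith) (N + 4)
  set L : ℝ := 2 * Real.exp 1 * C with hL
  have hL0 : 0 < L := by positivity
  refine ⟨K + 3 * A * L * G, by positivity, fun t ht x => ?_⟩
  have ht0 : 0 < t := by linarith
  have hJ := continuous_besselJ
  have hJ' := continuous_besselJ'
  have hfx := hpos x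
  have hflow : f x ≤ L * t * S t f x := le_mul_S hf hpos hC hnear ht x
  rw [(hasDerivAt_S hf ht0 x).deriv]
  set τ : ℝ := t ^ (-2 * (1 - σ)) with hτ
  set ε : ℝ := Real.exp (-(t ^ (2 * σ - 1) / 4)) with hε
  have hε0 : 0 < ε := Real.exp_pos _
  have hτ0 : 0 < τ := Real.rpow_pos_of_pos ht0 _
  have hτt : 1 ≤ t * τ := by
    have h := Real.one_le_rpow (x := t) (z := 1 + -2 * (1 - σ)) (by linarith) (by linarith)
    rwa [Real.rpow_add ht0, Real.rpow_one] at h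
  set k : ℝ → ℝ := fun y => 2 * t * besselJ' (t ^ 2 - y ^ 2) - besselJ (t ^ 2 - y ^ 2) / 2 with hk
  set E : ℝ := Real.exp (-t / 2) / 2 with hE
  have hE0 : 0 < E := by positivity
  have hpt : ∀ y ∈ Icc (-t) t, |E * (k y * f (x - y))| ≤
      K * τ * (E * (besselJ (t ^ 2 - y ^ 2) * f (x - y))) + t * ε * (A * t ^ N * f x) := by
    intro y hy
    have hyt : |y| ≤ t := abs_le.2 hy
    have hw : 0 ≤ t ^ 2 - y ^ 2 := by nlinarith [hy.1, hy.2]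
    have hJ1 := one_le_besselJ hw
    have hfy := hpos (x - y)
    rw [abs_mul, abs_mul, abs_of_pos hE0, abs_of_pos hfy]
    rcases le_or_gt |y| (t ^ σ) with h | h
    · refine le_add_of_le_of_nonneg ?_ (by positivity)
      calc E * (|k y| * f (x - y))
          ≤ E * (K * τ * besselJ (t ^ 2 - y ^ 2) * f (x - y)) := by
            gcongr; exact hker t y ht h
        _ = _ := by ring
    · refine le_add_of_nonneg_of_le (by positivity) ?_
      have h1 := exp_mul_besselJ_le ht0 h.le hyt
      calc E * (|k y| * f (x - y))
          ≤ E * (t * besselJ (t ^ 2 - y ^ 2) * f (x - y)) := by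
            gcongr; exact abs_kernel_deriv_le ht hw
        _ = t * (Real.exp (-t / 2) * besselJ (t ^ 2 - y ^ 2)) * f (x - y) / 2 := by
            rw [hE]; ring
        _ ≤ t * (Real.exp (-t / 2) * besselJ (t ^ 2 - y ^ 2)) * f (x - y) := by
            exact half_le_self (by positivity)
        _ ≤ t * ε * (A * t ^ N * f x) := by
            gcongr; exact hgrow t ht x y hyt
  have hint : |E * ∫ y in (-t)..t, k y * f (x - y)| ≤
      K * τ * S t f x + 2 * t * (t * ε * (A * t ^ N * f x)) := by
    rw [← intervalIntegral.integral_const_mul]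
    refine (intervalIntegral.abs_integral_le_integral_abs (by linarith)).trans ?_
    refine (intervalIntegral.integral_mono_on (by linarith)
      (Continuous.intervalIntegrable (by fun_prop) _ _)
      (Continuous.intervalIntegrable (by fun_prop) _ _) hpt).trans_eq ?_
    rw [intervalIntegral.integral_add (Continuous.intervalIntegrable (by fun_prop) _ _)
      intervalIntegrable_const, intervalIntegral.integral_const,
      intervalIntegral.integral_const_mul, intervalIntegral.integral_const_mul,
      ← S_eq_integral_besselJ ht0.le, smul_eq_mul]
    ring
  have hbd : |E * (f (x - t) + f (x + t))| ≤ ε * (A * t ^ N * f x) := by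
    have h1 := hgrow t ht x t (abs_of_pos ht0).le
    have h2 := hgrow t ht x (-t) (by rw [abs_neg, abs_of_pos ht0])
    rw [sub_neg_eq_add] at h2
    have h3 : Real.exp (-t / 2) ≤ ε := by
      have h := exp_mul_besselJ_le (σ := σ) (y := t) ht0 (by
        rw [abs_of_pos ht0]
        exact (Real.rpow_le_rpow_of_exponent_le (by linarith) hσ'.le).trans_eq
          (Real.rpow_one t)) (abs_of_pos ht0).le
      rwa [sub_self, besselJ_zero, mul_one] at h
    have h4 := hpos (x - t)
    have h5 := hpos (x + t)
    rw [abs_of_pos (by positivity)]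
    calc E * (f (x - t) + f (x + t)) ≤ E * (A * t ^ N * f x + A * t ^ N * f x) := by gcongr
      _ = Real.exp (-t / 2) * (A * t ^ N * f x) := by rw [hE]; ring
      _ ≤ _ := by gcongr
  have hS : 0 ≤ S t f x := by
    by_contra hS
    have : L * t * S t f x < 0 := mul_neg_of_pos_of_neg (by positivity) (not_le.1 hS)
    linarith
  -- the far contribution is smaller than any power of `t` relative to `S t f x`
  have hrest : (2 * t * t + 1) * (ε * (A * t ^ N * f x)) ≤ 3 * A * L * G * τ * S t f x := by
    have ht2 : 2 * t * t + 1 ≤ 3 * t ^ 2 := by nlinarith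
    calc (2 * t * t + 1) * (ε * (A * t ^ N * f x))
        ≤ 3 * t ^ 2 * (ε * (A * t ^ N * (L * t * S t f x))) := by gcongr
      _ = 3 * A * L * (t ^ (N + 3) * ε * 1) * S t f x := by ring
      _ ≤ 3 * A * L * (t ^ (N + 3) * ε * (t * τ)) * S t f x := by gcongr
      _ = 3 * A * L * (t ^ (N + 4) * ε) * τ * S t f x := by ring
      _ ≤ 3 * A * L * G * τ * S t f x := by gcongr; exact hexp t (by linarith)
  rw [mul_add]
  refine (abs_add_le _ _).trans ((add_le_add hbd hint).trans ?_)
  have e : ε * (A * t ^ N * f x) + (K * τ * S t f x + 2 * t * (t * ε * (A * t ^ N * f x))) =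
      K * τ * S t f x + (2 * t * t + 1) * (ε * (A * t ^ N * f x)) := by ring
  rw [e]
  linarith

end DampedWave

theorem lemma3p2 (φ : ℝ → ℝ) (hφ_nonneg : ∀ᵐ x : ℝ, 0 ≤ φ x)
    (hφ_L1 : MemLp φ 1 volume) (hφ_Linf : MemLp φ ⊤ volume)
    (hφ : DampedWave.WeightConditions φ) :
    ∀ σ : ℝ, 1 / 2 < σ → σ < 1 →
      ∃ Cσ : ℝ, 0 < Cσ ∧ ∀ t : ℝ, 2 ≤ t → ∀ x : ℝ,
        DifferentiableAt ℝ (fun s : ℝ => DampedWave.S s φ x) t ∧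
        |deriv (fun s : ℝ => DampedWave.S s φ x) t| ≤
          Cσ * t ^ (-2 * (1 - σ)) * DampedWave.S t φ x := by
  intro σ hσ hσ'
  obtain ⟨f, hf, hφf, hpos, C, hC, hnear, hfar⟩ := hφ.exists_continuous_rep hφ_nonneg hφ_Linf
  obtain ⟨B, hB, hbound⟩ := DampedWave.exists_abs_deriv_S_le hf hpos hC hnear hfar hσ hσ'
  simp_rw [DampedWave.S_congr_ae hφf]
  exact ⟨B, hB, fun t ht x =>
    ⟨(DampedWave.hasDerivAt_S hf (by linarith) x).differentiableAt, hbound t ht x⟩⟩
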